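/- All graphs are finite and simple, and the Laplacian spectrum of a graph is the multiset of eigenvalues (with multiplicities) of its Laplacian matrix $L = D - A$. For integers $n, m, i, j$ with $0 < i < j \le n$ and $0\le m\le n$, let $$S_{\{i,j\}_n^m} = \{0,1,\dots,m-1,m,m,m+1,\dots,n-1,n\}\setminus\{i,j\},$$ the multiset of the integers from $0$ to $n$ in which $m$ is listed twice and from which all occurrences of $i$ and $j$ are removed. It is called Laplacian realizable if there is a connected graph on $n$ vertices whose Laplacian spectrum is $S_{\{i,j\}_n^m}$. **Theorem.** Let $n \ge 6$. Among the sets $S_{\{i,n-2\}_n^2}$ with $1 < i < n-2$, the Laplacian realizable ones are exactly the following: (i) if $n \equiv 0 \pmod 4$: the sets $S_{\{2k+2,\,n-2\}_n^2}$ for $k = 1, 2, \dots, \frac{n-6}{2}$; (ii) if $n \equiv 1 \pmod 4$: the sets $S_{\{2k+2,\,n-2\}_n^2}$ for $k = 1, 2, \dots, \frac{n-5}{2}$; (iii) if $n \equiv 2 \pmod 4$: the sets $S_{\{2k+1,\,n-2\}_n^2}$ for $k = 1, 2, \dots, \frac{n-4}{2}$; (iv) if $n \equiv 3 \pmod 4$: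 the sets $S_{\{2k+1,\,n-2\}_n^2}$ for $k = 1, 2, \dots, \frac{n-5}{2}$. -/

import Mathlib

namespace LaplacianRealizable

open Classical in
/-- The Laplacian spectrum of a finite simple graph: the multiset of eigenvalues, with
multiplicity, of its Laplacian matrix (this matrix is real symmetric, so its characteristic
polynomial splits over `ℝ`). -/
noncomputable def laplacianSpectrum {V : Type*} [Fintype V] (G : SimpleGraph V) : Multiset ℝ :=
  (G.lapMatrix ℝ).charpoly.roots

/-- The multiset `{0, 1, …, m-1, m, m, m+1, …, n} \ {i, j}`: the integers from `0` to `n`, with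
`m` listed twice, from which all occurrences of `i` and `j` are removed. -/
def S (i j n m : ℕ) : Multiset ℕ :=
  (m ::ₘ Multiset.range (n + 1)).filter fun x => x ≠ i ∧ x ≠ j

/-- A graph on `n` vertices realizes `S i j n m` if it is connected and its Laplacian spectrum
(with multiplicities) is `S i j n m`. -/
def Realizes {n : ℕ} (G : SimpleGraph (Fin n)) (i j m : ℕ) : Prop :=
  G.Connected ∧ laplacianSpectrum G = (S i j n m).map (fun x : ℕ => (x : ℝ))

/-- `S i j n m` is Laplacian realizable if some connected simple graph on `n` vertices
realizes it. -/
def IsRealizable (i j n m : ℕ) : Prop :=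
  ∃ G : SimpleGraph (Fin n), Realizes G i j m

end LaplacianRealizable

namespace LaplacianRealizable

open Polynomial Matrix

/-! Necessity is counting. The eigenvalues number `n`, which excludes `i = 2`, and they sum to the
trace, twice the number of edges, which fixes the parity of `i`. Sufficiency is a construction.
Disjoint union adds spectra. A join drops one 0 from each side, shifts each side by the order of the
other, and adds 0 and the total order. The realizing graph is K₁ ∨ (K₁ + (K₁ ∨ Q)), where Q has
spectrum {0, 0, 0, 1, …, n - 5} without `i - 2` (`isSpectrum_triple_zero`). Q is assembled from
graphs with spectrum {0, …, m} without `p` (`isSpectrum_rangeExcept`). -/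

/-! ### Laplacian polynomials of unions and joins -/

theorem lapMatrix_apply {V : Type*} [Fintype V] [DecidableEq V] (G : SimpleGraph V)
    [DecidableRel G.Adj] (i j : V) :
    G.lapMatrix ℝ i j = (if i = j then ∑ k, (if G.Adj i k then (1 : ℝ) else 0) else 0) -
      if G.Adj i j then 1 else 0 := by
  rw [← SimpleGraph.degree_eq_sum_if_adj]
  simp [SimpleGraph.lapMatrix, SimpleGraph.degMatrix, Matrix.diagonal_apply,
    SimpleGraph.adjMatrix_apply]

/-- With J the all-ones matrix, AJ = 0 gives (X - A)(X - J) = X(X - (A + J)); take determinants.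
Adding J thus moves one eigenvalue 0 to the order. -/
theorem X_sub_card_mul_charpoly_of_row_sums_zero {V : Type*} [Fintype V] [DecidableEq V]
    (A : Matrix V V ℝ) (hA : A *ᵥ (fun _ => 1) = 0) :
    (X - C (Fintype.card V : ℝ)) * A.charpoly =
      X * (A + vecMulVec (fun _ => 1) (fun _ => 1)).charpoly := by
  set J : Matrix V V ℝ := vecMulVec (fun _ => 1) (fun _ => 1) with hJ
  have hAJ : A * J = 0 := by
    rw [hJ, mul_vecMulVec, hA]; ext; simp [vecMulVec]
  have h1 : A.charmatrix * J.charmatrix = (X : ℝ[X]) • (A + J).charmatrix := by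
    have := congrArg (C.mapMatrix (m := V)) hAJ
    rw [map_mul, map_zero] at this
    simp only [charmatrix, mul_sub, sub_mul, this, map_add, scalar_apply, ← smul_eq_diagonal_mul,
      smul_sub, ← smul_eq_mul_diagonal, smul_add]
    ext i j : 1
    simp
    ring
  have h2 := congrArg det h1
  rw [det_mul, det_smul] at h2
  -- The extra factor X avoids the exponent `card V - 1` and covers empty `V`.
  have h3 : X * J.charpoly = X ^ Fintype.card V * (X - C (Fintype.card V : ℝ)) := by
    rw [hJ, charpoly_vecMulVec]
    rcases Nat.eq_zero_or_pos (Fintype.card V) with h | h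
    · simp [h, dotProduct]
    · obtain ⟨k, hk⟩ := Nat.exists_eq_add_of_lt h
      simp [hk, dotProduct, smul_eq_C_mul]
      ring
  change A.charpoly * J.charpoly = _ * (A + J).charpoly at h2
  have h4 : (X : ℝ[X]) ^ Fintype.card V ≠ 0 := pow_ne_zero _ X_ne_zero
  apply mul_left_cancel₀ h4
  linear_combination X * h2 - A.charpoly * h3

open Classical in
/-- The characteristic polynomial of the Laplacian matrix. -/
noncomputable def lapCharpoly {V : Type*} [Fintype V] (G : SimpleGraph V) : ℝ[X] :=
  (G.lapMatrix ℝ).charpoly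

theorem lapCharpoly_eq {V : Type*} [Fintype V] [DecidableEq V] (G : SimpleGraph V)
    [DecidableRel G.Adj] : lapCharpoly G = (G.lapMatrix ℝ).charpoly := by
  unfold lapCharpoly
  congr!

theorem lapCharpoly_of_iso {V W : Type*} [Fintype V] [Fintype W] {G : SimpleGraph V}
    {H : SimpleGraph W} (e : G ≃g H) : lapCharpoly H = lapCharpoly G := by
  classical
  have h : H.lapMatrix ℝ = Matrix.reindex e.toEquiv e.toEquiv (G.lapMatrix ℝ) := by
    ext i j
    obtain ⟨i, rfl⟩ := e.surjective i
    obtain ⟨j, rfl⟩ := e.surjective j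
    have hi : e.toEquiv.symm (e i) = i := e.toEquiv.symm_apply_apply i
    have hj : e.toEquiv.symm (e j) = j := e.toEquiv.symm_apply_apply j
    have hadj : H.Adj (e i) (e j) ↔ G.Adj i j := e.map_adj_iff
    rw [reindex_apply, submatrix_apply, hi, hj]
    simp [SimpleGraph.lapMatrix, SimpleGraph.degMatrix, Matrix.diagonal_apply,
      SimpleGraph.adjMatrix_apply, hadj]
  rw [lapCharpoly_eq, lapCharpoly_eq, h, charpoly_reindex]

theorem lapCharpoly_sum {V W : Type*} [Fintype V] [Fintype W] (G : SimpleGraph V)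
    (H : SimpleGraph W) : lapCharpoly (G ⊕g H) = lapCharpoly G * lapCharpoly H := by
  classical
  rw [lapCharpoly_eq, lapCharpoly_eq, lapCharpoly_eq, ← charpoly_fromBlocks_zero₁₂ _ 0]
  congr 1
  ext (i | i) (j | j) <;> simp [lapMatrix_apply, -Finset.sum_boole]

/-- The join of two graphs. -/
def join {V W : Type*} (G : SimpleGraph V) (H : SimpleGraph W) : SimpleGraph (V ⊕ W) :=
  (G ⊕g H) ⊔ completeBipartiteGraph V W

theorem join_adj_inl_inl {V W : Type*} (G : SimpleGraph V) (H : SimpleGraph W) (u v : V) :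
    (join G H).Adj (.inl u) (.inl v) ↔ G.Adj u v := by simp [join]

theorem join_adj_inl_inr {V W : Type*} (G : SimpleGraph V) (H : SimpleGraph W) (u : V) (v : W) :
    (join G H).Adj (.inl u) (.inr v) := by simp [join]

theorem join_adj_inr_inr {V W : Type*} (G : SimpleGraph V) (H : SimpleGraph W) (u v : W) :
    (join G H).Adj (.inr u) (.inr v) ↔ H.Adj u v := by simp [join]

theorem join_connected {V W : Type*} [Nonempty V] [Nonempty W] (G : SimpleGraph V)
    (H : SimpleGraph W) : (join G H).Connected := by
  obtain ⟨v₀⟩ := ‹Nonempty V›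
  obtain ⟨w₀⟩ := ‹Nonempty W›
  rw [SimpleGraph.connected_iff_exists_forall_reachable]
  refine ⟨Sum.inl v₀, ?_⟩
  rintro (v | w)
  · exact (join_adj_inl_inr G H v₀ w₀).reachable.trans (join_adj_inl_inr G H v w₀).symm.reachable
  · exact (join_adj_inl_inr G H v₀ w).reachable

/-- Adding the all-ones matrix cancels the -1 entries between the two sides, leaving a block
diagonal matrix. -/
theorem lapCharpoly_join {V W : Type*} [Fintype V] [DecidableEq V] [Fintype W] [DecidableEq W]
    (G : SimpleGraph V) [DecidableRel G.Adj] (H : SimpleGraph W) [DecidableRel H.Adj] :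
    (X - C (Fintype.card (V ⊕ W) : ℝ)) * lapCharpoly (join G H) = X *
      ((G.lapMatrix ℝ + vecMulVec (fun _ => 1) (fun _ => 1)).charpoly.comp
          (X - C (Fintype.card W : ℝ)) *
        (H.lapMatrix ℝ + vecMulVec (fun _ => 1) (fun _ => 1)).charpoly.comp
          (X - C (Fintype.card V : ℝ))) := by
  classical
  have h := X_sub_card_mul_charpoly_of_row_sums_zero _
    (SimpleGraph.lapMatrix_mulVec_const_eq_zero (R := ℝ) (join G H))
  have hblock : (join G H).lapMatrix ℝ + vecMulVec (fun _ => 1) (fun _ => 1) =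
      fromBlocks
        (G.lapMatrix ℝ + vecMulVec (fun _ => 1) (fun _ => 1) - scalar V (-(Fintype.card W : ℝ)))
        0 0
        (H.lapMatrix ℝ + vecMulVec (fun _ => 1) (fun _ => 1) -
          scalar W (-(Fintype.card V : ℝ))) := by
    ext (i | i) (j | j)
    · by_cases hij : i = j
      · simp [lapMatrix_apply, vecMulVec_apply, join_adj_inl_inl, join_adj_inl_inr,
          hij, -Finset.sum_boole]
        ring
      · simp [lapMatrix_apply, vecMulVec_apply, join_adj_inl_inl, hij]
    · simp [lapMatrix_apply, vecMulVec_apply, join_adj_inl_inr]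
    · simp [lapMatrix_apply, vecMulVec_apply, (join_adj_inl_inr G H _ _).symm]
    · by_cases hij : i = j
      · simp [lapMatrix_apply, vecMulVec_apply, join_adj_inr_inr, (join_adj_inl_inr G H _ _).symm,
          hij, -Finset.sum_boole]
        ring
      · simp [lapMatrix_apply, vecMulVec_apply, join_adj_inr_inr, hij]
  rw [hblock, charpoly_fromBlocks_zero₁₂, charpoly_sub_scalar, charpoly_sub_scalar] at h
  rw [lapCharpoly_eq, h]
  simp only [C_neg, ← sub_eq_add_neg]

/-! ### Integer spectra -/

/-- The monic real polynomial whose multiset of roots is `s`. -/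
noncomputable def rootPoly (s : Multiset ℕ) : ℝ[X] := (s.map fun a : ℕ => X - C (a : ℝ)).prod

theorem rootPoly_cons (a : ℕ) (s : Multiset ℕ) :
    rootPoly (a ::ₘ s) = (X - C (a : ℝ)) * rootPoly s := by simp [rootPoly]

theorem rootPoly_add (s t : Multiset ℕ) : rootPoly (s + t) = rootPoly s * rootPoly t := by
  simp [rootPoly]

theorem rootPoly_comp (s : Multiset ℕ) (k : ℕ) :
    (rootPoly s).comp (X - C (k : ℝ)) = rootPoly (s.map (· + k)) := by
  induction s using Multiset.induction_on with
  | empty => simp [rootPoly]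
  | cons a s ih =>
    rw [rootPoly_cons, mul_comp, ih, Multiset.map_cons, rootPoly_cons]
    congr 1
    simp
    ring

theorem roots_rootPoly (s : Multiset ℕ) : (rootPoly s).roots = s.map (fun x : ℕ => (x : ℝ)) := by
  have h := roots_multiset_prod_X_sub_C (s.map fun x : ℕ => (x : ℝ))
  rw [Multiset.map_map] at h
  exact h

/-- `s` is the Laplacian spectrum of some graph on `n` vertices. -/
def IsSpectrum (n : ℕ) (s : Multiset ℕ) : Prop :=
  ∃ G : SimpleGraph (Fin n), lapCharpoly G = rootPoly s

theorem isSpectrum_of_card_eq {V : Type*} [Fintype V] {n : ℕ} (hn : Fintype.card V = n)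
    {G : SimpleGraph V} {s : Multiset ℕ} (h : lapCharpoly G = rootPoly s) :
    IsSpectrum n s :=
  ⟨G.overFin hn, (lapCharpoly_of_iso (G.overFinIso hn)).trans h⟩

theorem IsSpectrum.add {m n : ℕ} {s t : Multiset ℕ} (hs : IsSpectrum m s) (ht : IsSpectrum n t) :
    IsSpectrum (m + n) (s + t) := by
  obtain ⟨G, hG⟩ := hs
  obtain ⟨H, hH⟩ := ht
  exact isSpectrum_of_card_eq (by simp)
    ((lapCharpoly_sum G H).trans (by rw [hG, hH, rootPoly_add]))

theorem charpoly_lapMatrix_add_ones {n : ℕ} {t : Multiset ℕ} {G : SimpleGraph (Fin n)}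
    [DecidableRel G.Adj] (h : lapCharpoly G = rootPoly (0 ::ₘ t)) :
    (G.lapMatrix ℝ + vecMulVec (fun _ => 1) (fun _ => 1)).charpoly = rootPoly (n ::ₘ t) := by
  have h1 := X_sub_card_mul_charpoly_of_row_sums_zero _
    (SimpleGraph.lapMatrix_mulVec_const_eq_zero (R := ℝ) G)
  apply mul_left_cancel₀ (X_ne_zero (R := ℝ))
  rw [← h1, ← lapCharpoly_eq, h, rootPoly_cons, rootPoly_cons]
  simp
  ring

theorem lapCharpoly_join_eq_rootPoly {m n : ℕ} {s t : Multiset ℕ} {G : SimpleGraph (Fin m)}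
    {H : SimpleGraph (Fin n)} (hG : lapCharpoly G = rootPoly (0 ::ₘ s))
    (hH : lapCharpoly H = rootPoly (0 ::ₘ t)) :
    lapCharpoly (join G H) = rootPoly (0 ::ₘ (m + n) ::ₘ (s.map (· + n) + t.map (· + m))) := by
  classical
  have h := lapCharpoly_join G H
  rw [charpoly_lapMatrix_add_ones hG, charpoly_lapMatrix_add_ones hH] at h
  simp only [Fintype.card_sum, Fintype.card_fin] at h
  apply mul_left_cancel₀ (X_sub_C_ne_zero ((m + n : ℕ) : ℝ))
  rw [h, rootPoly_comp, rootPoly_comp]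
  simp only [Multiset.map_cons, rootPoly_cons, rootPoly_add, add_comm n m]
  simp
  ring

theorem IsSpectrum.join {m n : ℕ} {s t : Multiset ℕ} (hs : IsSpectrum m (0 ::ₘ s))
    (ht : IsSpectrum n (0 ::ₘ t)) :
    IsSpectrum (m + n) (0 ::ₘ (m + n) ::ₘ (s.map (· + n) + t.map (· + m))) := by
  obtain ⟨G, hG⟩ := hs
  obtain ⟨H, hH⟩ := ht
  exact isSpectrum_of_card_eq (by simp) (lapCharpoly_join_eq_rootPoly hG hH)

theorem isSpectrum_one : IsSpectrum 1 {0} := by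
  refine ⟨⊥, ?_⟩
  rw [lapCharpoly_eq, show (⊥ : SimpleGraph (Fin 1)).lapMatrix ℝ = 0 by ext; simp [lapMatrix_apply],
    charpoly_zero]
  simp [rootPoly]

theorem isSpectrum_two : IsSpectrum 2 {0, 2} := isSpectrum_one.join isSpectrum_one

/-- The integers from `0` to `n` other than `p`. -/
def rangeExcept (n p : ℕ) : Multiset ℕ := (Multiset.range (n + 1)).filter (· ≠ p)

theorem count_range (n x : ℕ) : (Multiset.range n).count x = if x < n then 1 else 0 := by
  split_ifs with h
  · exact Multiset.count_eq_one_of_mem (Multiset.nodup_range n) (Multiset.mem_range.mpr h)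
  · exact Multiset.count_eq_zero_of_notMem (by simpa using h)

theorem count_rangeExcept (n p x : ℕ) :
    (rangeExcept n p).count x = if x ≤ n ∧ x ≠ p then 1 else 0 := by
  rw [rangeExcept, Multiset.count_filter, count_range]
  split_ifs <;> first | rfl | omega

theorem count_map_add (s : Multiset ℕ) (k x : ℕ) :
    (s.map (· + k)).count x = if k ≤ x then s.count (x - k) else 0 := by
  split_ifs with h
  · obtain ⟨y, rfl⟩ := Nat.exists_eq_add_of_le' h
    rw [Nat.add_sub_cancel]
    exact Multiset.count_map_eq_count' _ _ (add_left_injective k) y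
  · refine Multiset.count_eq_zero_of_notMem fun hx => h ?_
    obtain ⟨y, -, rfl⟩ := Multiset.mem_map.mp hx
    exact Nat.le_add_left k y

/-- The multiplicities of `u` are those of the spectrum of the join of a vertex with a graph on `n`
vertices whose spectrum is `s`. -/
def IsConeSpectrum (n : ℕ) (s u : Multiset ℕ) : Prop :=
  -- The term subtracted at `x = 1` is the 0 of `s` that the join drops, seen after the shift by 1.
  ∀ x, u.count x = (if x = 0 then 1 else s.count (x - 1)) - (if x = 1 then 1 else 0) +
    if x = n + 1 then 1 else 0

theorem IsConeSpectrum.eq {n : ℕ} {t u : Multiset ℕ} (hu : IsConeSpectrum n (0 ::ₘ t) u) :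
    0 ::ₘ (1 + n) ::ₘ ((0 : Multiset ℕ).map (· + n) + t.map (· + 1)) = u := by
  ext x
  rw [hu, Multiset.map_zero, zero_add]
  simp only [Multiset.count_cons, count_map_add]
  split_ifs <;> omega

theorem IsConeSpectrum.isSpectrum {n : ℕ} {s u : Multiset ℕ} (hu : IsConeSpectrum n s u)
    (h : IsSpectrum n s) (hs : 0 ∈ s) : IsSpectrum (n + 1) u := by
  obtain ⟨t, rfl⟩ := Multiset.exists_cons_of_mem hs
  rw [← hu.eq, add_comm n 1]
  exact isSpectrum_one.join h

theorem IsConeSpectrum.exists_connected {n : ℕ} {s u : Multiset ℕ} (hu : IsConeSpectrum n s u)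
    (h : IsSpectrum n s) (hs : 0 ∈ s) (hn : 0 < n) :
    ∃ G : SimpleGraph (Fin (n + 1)), G.Connected ∧ lapCharpoly G = rootPoly u := by
  obtain ⟨t, rfl⟩ := Multiset.exists_cons_of_mem hs
  obtain ⟨G, hG⟩ := isSpectrum_one
  obtain ⟨H, hH⟩ := h
  have hc : Fintype.card (Fin 1 ⊕ Fin n) = n + 1 := by simp [add_comm]
  have : Nonempty (Fin n) := ⟨⟨0, hn⟩⟩
  refine ⟨(LaplacianRealizable.join G H).overFin hc,
    (SimpleGraph.overFinIso _ hc).connected_iff.mp (join_connected G H), ?_⟩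
  rw [lapCharpoly_of_iso (SimpleGraph.overFinIso _ hc), ← hu.eq]
  exact lapCharpoly_join_eq_rootPoly hG hH

/-! ### Constructions -/

/-- `hpar` says that the sum is even. A cone over K₁ + H raises the gap of H by 1; the extreme gaps
1 and `n - 1` need other joins. -/
theorem isSpectrum_rangeExcept (n p : ℕ) (hp : 0 < p) (hpn : p < n)
    (hpar : (n % 4 = 0 ∨ n % 4 = 3) ∧ p % 2 = 0 ∨ (n % 4 = 1 ∨ n % 4 = 2) ∧ p % 2 = 1) :
    IsSpectrum n (rangeExcept n p) := by
  induction n using Nat.strong_induction_on generalizing p with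
  | _ n ih =>
  by_cases h2 : n = 2
  · obtain rfl : p = 1 := by omega
    subst h2
    exact isSpectrum_two
  by_cases h3 : n = 3
  · obtain rfl : p = 2 := by omega
    subst h3
    refine IsConeSpectrum.isSpectrum (s := {0} + {0}) ?_ (isSpectrum_one.add isSpectrum_one)
      (by simp)
    intro x
    simp only [Multiset.count_add, Multiset.count_singleton, count_rangeExcept]
    split_ifs <;> omega
  by_cases hp1 : p = 1
  · subst hp1
    obtain ⟨k, rfl⟩ := Nat.exists_eq_add_of_le (show 5 ≤ n by omega)
    -- 2K₁ ∨ (K₁ + H), with H of order `n - 3` and gap `n - 4`: the shift by 2 moves this gap to `n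
    -- - 2`, which the second 0 of 2K₁ fills.
    have h := ih (k + 2) (by omega) (k + 1) (by omega) (by omega) (by omega)
    have h₁ : IsSpectrum 2 (0 ::ₘ {0}) := isSpectrum_one.add isSpectrum_one
    have h₂ : IsSpectrum (1 + (k + 2)) (0 ::ₘ rangeExcept (k + 2) (k + 1)) := by
      simpa using isSpectrum_one.add h
    convert h₁.join h₂ using 1
    · omega
    · ext x
      simp only [Multiset.count_add, Multiset.count_cons, count_map_add, count_rangeExcept,
        Multiset.count_singleton]
      split_ifs <;> omega
  by_cases hpn1 : p = n - 1
  · obtain ⟨k, rfl⟩ := Nat.exists_eq_add_of_le (show 6 ≤ n by omega)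
    -- K₂ fills the gap 2, so the cone is over {0, 0, 1, …, n - 3}.
    have h := ih (k + 3) (by omega) 2 (by omega) (by omega) (by omega)
    rw [show 6 + k = 2 + (k + 3) + 1 by omega]
    refine IsConeSpectrum.isSpectrum (s := {0, 2} + rangeExcept (k + 3) 2) ?_
      (isSpectrum_two.add h) (by simp)
    intro x
    simp only [Multiset.count_add, Multiset.insert_eq_cons, Multiset.count_cons,
      Multiset.count_singleton, count_rangeExcept]
    split_ifs <;> omega
  · obtain ⟨k, rfl⟩ := Nat.exists_eq_add_of_le (show 4 ≤ n by omega)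
    have h := ih (k + 2) (by omega) (p - 1) (by omega) (by omega) (by omega)
    rw [show 4 + k = 1 + (k + 2) + 1 by omega]
    refine IsConeSpectrum.isSpectrum (s := {0} + rangeExcept (k + 2) (p - 1)) ?_
      (isSpectrum_one.add h) (by simp)
    intro x
    simp only [Multiset.count_add, Multiset.count_singleton, count_rangeExcept]
    split_ifs <;> omega

/-- The multiset `{0, 0, 0, 1, …, n - 2}` without the positive integer `p` is a Laplacian spectrum
whenever its sum is even. -/
theorem isSpectrum_triple_zero (n p : ℕ) (hn : 3 ≤ n) (hp : 0 < p) (hpn : p ≤ n - 2)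
    (hpar : (n % 4 = 1 ∨ n % 4 = 2) ∧ p % 2 = 0 ∨ (n % 4 = 0 ∨ n % 4 = 3) ∧ p % 2 = 1) :
    IsSpectrum n (0 ::ₘ 0 ::ₘ rangeExcept (n - 2) p) := by
  by_cases h3 : n = 3
  · obtain rfl : p = 1 := by omega
    subst h3
    exact isSpectrum_one.add (isSpectrum_one.add isSpectrum_one)
  by_cases hpn2 : p = n - 2
  · obtain ⟨k, rfl⟩ := Nat.exists_eq_add_of_le (show 6 ≤ n by omega)
    -- Here no gap lies below the top, and K₂ again fills the gap 2.
    have h := isSpectrum_rangeExcept (k + 3) 2 (by omega) (by omega) (by omega)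
    convert isSpectrum_one.add (isSpectrum_two.add h) using 1
    · omega
    · ext x
      simp only [Multiset.count_add, Multiset.insert_eq_cons, Multiset.count_cons,
        Multiset.count_singleton, count_rangeExcept]
      split_ifs <;> omega
  · obtain ⟨k, rfl⟩ := Nat.exists_eq_add_of_le' (show 2 ≤ n by omega)
    have h := isSpectrum_rangeExcept k p (by omega) (by omega) (by omega)
    convert isSpectrum_one.add (isSpectrum_one.add h) using 1
    · omega
    · simp

theorem count_S (i j n m x : ℕ) : (S i j n m).count x =
    if x ≠ i ∧ x ≠ j then (if x = m then 1 else 0) + (if x ≤ n then 1 else 0) else 0 := by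
  rw [S, Multiset.count_filter, Multiset.count_cons, count_range]
  simp only [Nat.lt_succ_iff, add_comm]

theorem isRealizable_of_parity {n i : ℕ} (hn : 6 ≤ n) (hi : 2 < i) (hin : i < n - 2)
    (hpar : (n % 4 = 0 ∨ n % 4 = 1) ∧ i % 2 = 0 ∨ (n % 4 = 2 ∨ n % 4 = 3) ∧ i % 2 = 1) :
    IsRealizable i (n - 2) n 2 := by
  obtain ⟨k, rfl⟩ := Nat.exists_eq_add_of_le' hn
  -- Two cones shift the gap `i - 2` to `i`; the inner one leaves a second 1, which the outer one
  -- turns into the repeated 2.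
  have hQ := isSpectrum_triple_zero (k + 3) (i - 2) (by omega) (by omega) (by omega) (by omega)
  have hF := isSpectrum_one.add (isSpectrum_one.join hQ)
  rw [show 1 + (1 + (k + 3)) = k + 5 by omega] at hF
  refine (IsConeSpectrum.exists_connected (u := S i (k + 6 - 2) (k + 6) 2) ?_ hF (by simp)
    (by omega)).imp fun G hG => ⟨hG.1, ?_⟩
  · intro x
    simp only [count_S, Multiset.count_add, Multiset.count_cons, count_map_add,
      Multiset.count_singleton, count_rangeExcept, Multiset.count_zero]
    split_ifs <;> omega
  · change (lapCharpoly G).roots = _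
    rw [hG.2, roots_rootPoly]

/-! ### Necessity: order and trace -/

theorem card_laplacianSpectrum {V : Type*} [Fintype V] (G : SimpleGraph V) :
    (laplacianSpectrum G).card = Fintype.card V := by
  classical
  change (lapCharpoly G).roots.card = _
  rw [lapCharpoly_eq, ← (G.isHermitian_lapMatrix ℝ).splits_charpoly.natDegree_eq_card_roots,
    charpoly_natDegree_eq_dim]

theorem sum_laplacianSpectrum {V : Type*} [Fintype V] (G : SimpleGraph V) :
    ∃ e : ℕ, (laplacianSpectrum G).sum = ((2 * e : ℕ) : ℝ) := by
  classical
  refine ⟨G.edgeFinset.card, ?_⟩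
  change (lapCharpoly G).roots.sum = _
  rw [lapCharpoly_eq, ← trace_eq_sum_roots_charpoly_of_splits
    (G.isHermitian_lapMatrix ℝ).splits_charpoly, ← G.sum_degrees_eq_twice_card_edges]
  simp [SimpleGraph.lapMatrix, SimpleGraph.degMatrix, trace_sub]

theorem cons_cons_S {i n : ℕ} (hi : i < n - 2) (hi2 : i ≠ 2) (hn : n ≠ 4) :
    i ::ₘ (n - 2) ::ₘ S i (n - 2) n 2 = 2 ::ₘ Multiset.range (n + 1) := by
  ext x
  simp only [Multiset.count_cons, count_S, count_range]
  split_ifs <;> omega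

theorem cons_cons_S_two {n : ℕ} (hn : 4 < n) :
    2 ::ₘ (n - 2) ::ₘ S 2 (n - 2) n 2 = Multiset.range (n + 1) := by
  ext x
  simp only [Multiset.count_cons, count_S, count_range]
  split_ifs <;> omega

theorem parity_of_isRealizable {n i : ℕ} (hn : 6 ≤ n) (hi : 1 < i) (hin : i < n - 2)
    (h : IsRealizable i (n - 2) n 2) :
    2 < i ∧
      ((n % 4 = 0 ∨ n % 4 = 1) ∧ i % 2 = 0 ∨ (n % 4 = 2 ∨ n % 4 = 3) ∧ i % 2 = 1) := by
  obtain ⟨G, -, hG⟩ := h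
  have hi2 : i ≠ 2 := by
    rintro rfl
    -- Removing 2 deletes both copies, leaving only `n - 1` values.
    have hcard := congrArg Multiset.card hG
    have hS := congrArg Multiset.card (cons_cons_S_two (n := n) (by omega))
    rw [card_laplacianSpectrum, Multiset.card_map, Fintype.card_fin] at hcard
    simp only [Multiset.card_cons, Multiset.card_range] at hS
    omega
  refine ⟨by omega, ?_⟩
  obtain ⟨e, he⟩ := sum_laplacianSpectrum G
  have hsum : (S i (n - 2) n 2).sum = 2 * e := by
    rw [hG] at he
    have hcast := map_multiset_sum (Nat.castRingHom ℝ) (S i (n - 2) n 2)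
    exact Nat.cast_injective (R := ℝ) (hcast.trans he)
  have hS := congrArg Multiset.sum (cons_cons_S hin hi2 (by omega))
  have hr : (Multiset.range (n + 1)).sum * 2 = (n + 1) * n := by
    have := Finset.sum_range_id_mul_two (n + 1)
    simpa [Finset.sum] using this
  simp only [Multiset.sum_cons, hsum] at hS
  -- For each residue the sum is linear in q and q², so the parity can be read off.
  obtain ⟨q, r, hr4, rfl⟩ : ∃ q r, r < 4 ∧ n = 4 * q + r :=
    ⟨n / 4, n % 4, Nat.mod_lt _ (by norm_num), (Nat.div_add_mod n 4).symm⟩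
  interval_cases r <;> ring_nf at hr hS hin hn ⊢ <;> omega

end LaplacianRealizable

theorem theorem4p3 (n : ℕ) (hn : 6 ≤ n) :
    (n % 4 = 0 →
      {i : ℕ | 1 < i ∧ i < n - 2 ∧ LaplacianRealizable.IsRealizable i (n - 2) n 2} =
        {i : ℕ | ∃ k : ℕ, 1 ≤ k ∧ k ≤ (n - 6) / 2 ∧ i = 2 * k + 2}) ∧
    (n % 4 = 1 →
      {i : ℕ | 1 < i ∧ i < n - 2 ∧ LaplacianRealizable.IsRealizable i (n - 2) n 2} =
        {i : ℕ | ∃ k : ℕ, 1 ≤ k ∧ k ≤ (n - 5) / 2 ∧ i = 2 * k + 2}) ∧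
    (n % 4 = 2 →
      {i : ℕ | 1 < i ∧ i < n - 2 ∧ LaplacianRealizable.IsRealizable i (n - 2) n 2} =
        {i : ℕ | ∃ k : ℕ, 1 ≤ k ∧ k ≤ (n - 4) / 2 ∧ i = 2 * k + 1}) ∧
    (n % 4 = 3 →
      {i : ℕ | 1 < i ∧ i < n - 2 ∧ LaplacianRealizable.IsRealizable i (n - 2) n 2} =
        {i : ℕ | ∃ k : ℕ, 1 ≤ k ∧ k ≤ (n - 5) / 2 ∧ i = 2 * k + 1}) := by
  refine ⟨fun hmod => ?_, fun hmod => ?_, fun hmod => ?_, fun hmod => ?_⟩ <;> ext i <;>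
    refine ⟨fun ⟨hi, hin, h⟩ => ?_, fun ⟨k, hk, hkn, hik⟩ => ?_⟩
  on_goal 1 => refine ⟨(i - 2) / 2, ?_⟩
  on_goal 3 => refine ⟨(i - 2) / 2, ?_⟩
  on_goal 5 => refine ⟨(i - 1) / 2, ?_⟩
  on_goal 7 => refine ⟨(i - 1) / 2, ?_⟩
  all_goals first
    | have hpar := LaplacianRealizable.parity_of_isRealizable hn hi hin h
      omega
    | have hpar : 2 < i ∧ i < n - 2 := by omega
      exact ⟨by omega, hpar.2, LaplacianRealizable.isRealizable_of_parity hn hpar.1 hpar.2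
        (by omega)⟩
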